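/- For a set $K\subset\mathbb R^2$ let $K^*=\{x\in\mathbb R^2 : x\cdot y\le 1 \text{ for all } y\in K\}$ be its polar body, and let $\mathcal P(K)=V(K)\,V(K^*)$ be its volume product, where $V$ denotes area. Let $K\subset\mathbb R^2$ be a convex body (a compact convex set with non-empty interior) that is origin-symmetric ($K=-K$), and let $S\subset\mathbb R^2$ be a (non-degenerate, solid) square centered at the origin. Then $$\mathcal P(K)\ \ge\ \mathcal P(S),\qquad\text{and}\qquad \mathcal P(S)=8.$$ -/

import Mathlib

open MeasureTheory

/-- The polar body `K* = {x : ⟨x, y⟩ ≤ 1 for all y ∈ K}` of a set `K ⊆ ℝⁿ`. -/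
def polarBody {n : ℕ} (K : Set (EuclideanSpace ℝ (Fin n))) : Set (EuclideanSpace ℝ (Fin n)) :=
  {x | ∀ y ∈ K, inner ℝ x y ≤ 1}

/-- The volume product `V(K) V(K*)`, with `V` the `n`-dimensional Lebesgue measure, as a real
number. -/
noncomputable def volumeProduct {n : ℕ} (K : Set (EuclideanSpace ℝ (Fin n))) : ℝ :=
  volume.real K * volume.real (polarBody K)

/-- A (non-degenerate, solid) square in the plane centered at the origin: the convex hull of its
four vertices `a, b, -a, -b`, where the half-diagonals `a`, `b` are orthogonal, of equal length,
and nonzero. -/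
def IsCenteredSquare (S : Set (EuclideanSpace ℝ (Fin 2))) : Prop :=
  ∃ a b : EuclideanSpace ℝ (Fin 2),
    a ≠ 0 ∧ ‖a‖ = ‖b‖ ∧ inner ℝ a b = 0 ∧ S = convexHull ℝ {a, b, -a, -b}

/-! A parallelogram of maximal area inscribed in `C` gives vectors `u`, `v` in `C` whose dual basis
`u'`, `v'` lies in the polar (`exists_auerbach_basis`). These frames cut both bodies into matching
sectors. If a sector of `C` has area `V`, comparison with triangles bounds the functional `u' + v'`
on `C` by `2V / |cross u v|`, so a multiple of `u' + v'` lies in the polar. The same bound in the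
polar, tested at that point, gives `V V' ≥ 1/2` (`half_le_volume_mul_volume`). With `A`, `B` the
areas of two adjacent sectors and `A'`, `B'` their polar partners, symmetry bounds the volume
product below by `4 (A + B) (A' + B')`. Here `AA'` and `BB'` are at least `1/2`, and AM-GM gives
`AB' + A'B ≥ 1`, hence `8`. For a square, both bodies are linear images of `[-1, 1]²` whose
determinants multiply to `±1/2`. -/

/-- The cross product (determinant) of two vectors of the plane. -/
def cross (u v : EuclideanSpace ℝ (Fin 2)) : ℝ := u 0 * v 1 - u 1 * v 0

theorem inner_eq_coords (u v : EuclideanSpace ℝ (Fin 2)) :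
    inner ℝ u v = u 0 * v 0 + u 1 * v 1 := by
  simp [PiLp.inner_apply, Fin.sum_univ_two, mul_comm]

theorem ext_coords {u v : EuclideanSpace ℝ (Fin 2)} (h0 : u 0 = v 0) (h1 : u 1 = v 1) :
    u = v := by
  ext i
  fin_cases i
  · exact h0
  · exact h1

/-- The linear map sending the standard basis of the plane to `u`, `v`. -/
noncomputable def frameMap (u v : EuclideanSpace ℝ (Fin 2)) :
    EuclideanSpace ℝ (Fin 2) →ₗ[ℝ] EuclideanSpace ℝ (Fin 2) where
  toFun c := c 0 • u + c 1 • v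
  map_add' c d := by simp only [PiLp.add_apply]; module
  map_smul' r c := by simp only [PiLp.smul_apply, smul_eq_mul, RingHom.id_apply]; module

theorem frameMap_apply (u v c : EuclideanSpace ℝ (Fin 2)) :
    frameMap u v c = c 0 • u + c 1 • v := rfl

theorem det_frameMap (u v : EuclideanSpace ℝ (Fin 2)) :
    LinearMap.det (frameMap u v) = cross u v := by
  rw [← LinearMap.det_toMatrix (EuclideanSpace.basisFun (Fin 2) ℝ).toBasis, Matrix.det_fin_two]
  simp [LinearMap.toMatrix_apply, frameMap_apply, cross]
  ring

theorem volume_real_image_frameMap (u v : EuclideanSpace ℝ (Fin 2))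
    (s : Set (EuclideanSpace ℝ (Fin 2))) :
    volume.real (frameMap u v '' s) = |cross u v| * volume.real s := by
  simp [measureReal_def, Measure.addHaar_image_linearMap, det_frameMap]

theorem volume_real_preimage_coords (s : Set (ℝ × ℝ)) (hs : MeasurableSet s) :
    volume.real {c : EuclideanSpace ℝ (Fin 2) | (c 0, c 1) ∈ s} = volume.real s := by
  have h := ((volume_preserving_finTwoArrow ℝ).comp
    (EuclideanSpace.volume_preserving_symm_measurableEquiv_toLp (Fin 2)))
  rw [measureReal_def, measureReal_def, ← h.measure_preimage hs.nullMeasurableSet]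
  rfl

/-- The open standard triangle. -/
def stdTriangle : Set (EuclideanSpace ℝ (Fin 2)) := {c | 0 < c 0 ∧ 0 < c 1 ∧ c 0 + c 1 < 1}

theorem volume_real_stdTriangle : volume.real stdTriangle = 1 / 2 := by
  have hr : MeasurableSet (regionBetween (fun _ : ℝ => (0 : ℝ)) (fun x => 1 - x)
      (Set.Ioc 0 1)) :=
    measurableSet_regionBetween measurable_const (by fun_prop) measurableSet_Ioc
  have h : stdTriangle = {c | (c 0, c 1) ∈ regionBetween (fun _ : ℝ => (0 : ℝ))
      (fun x => 1 - x) (Set.Ioc 0 1)} := by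
    ext c
    simp only [stdTriangle, regionBetween, Set.mem_ofPred_eq, Set.mem_Ioc, Set.mem_Ioo]
    constructor
    · rintro ⟨h0, h1, h2⟩
      refine ⟨⟨?_, ?_⟩, ?_, ?_⟩ <;> linarith
    · rintro ⟨⟨h0, -⟩, h1, h2⟩
      refine ⟨?_, ?_, ?_⟩ <;> linarith
  rw [h, volume_real_preimage_coords _ hr, measureReal_def, Measure.volume_eq_prod,
    volume_regionBetween_eq_integral (by exact (by fun_prop : Continuous _).integrableOn_Ioc)
      (by exact (by fun_prop : Continuous _).integrableOn_Ioc) measurableSet_Ioc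
      (fun x hx => by linarith [hx.2])]
  have hint : ∫ x in (0 : ℝ)..1, (1 - x) = 1 / 2 := by
    rw [intervalIntegral.integral_sub (by simp) (by simp)]
    norm_num [integral_id]
  rw [← intervalIntegral.integral_of_le zero_le_one]
  simp only [Pi.sub_apply, sub_zero, hint]
  exact ENNReal.toReal_ofReal (by norm_num)

/-- The closed standard square `[-1, 1]²`. -/
def stdSquare : Set (EuclideanSpace ℝ (Fin 2)) :=
  {c | c 0 ∈ Set.Icc (-1 : ℝ) 1 ∧ c 1 ∈ Set.Icc (-1 : ℝ) 1}

theorem volume_real_stdSquare : volume.real stdSquare = 4 := by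
  have h := volume_real_preimage_coords (Set.Icc (-1 : ℝ) 1 ×ˢ Set.Icc (-1 : ℝ) 1)
    (measurableSet_Icc.prod measurableSet_Icc)
  rw [Measure.volume_eq_prod, measureReal_prod_prod] at h
  refine (Eq.trans ?_ h).trans ?_
  · rfl
  · simp; norm_num

/-! ### Dual bases. -/

/-- `u, v` and `u', v'` are dual bases of the plane. -/
structure IsDualPair (u v u' v' : EuclideanSpace ℝ (Fin 2)) : Prop where
  uu : inner ℝ u u' = 1
  uv : inner ℝ u v' = 0
  vu : inner ℝ v u' = 0
  vv : inner ℝ v v' = 1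

namespace IsDualPair

variable {u v u' v' : EuclideanSpace ℝ (Fin 2)}

theorem symm (h : IsDualPair u v u' v') : IsDualPair u' v' u v :=
  ⟨by rw [real_inner_comm]; exact h.uu, by rw [real_inner_comm]; exact h.vu,
    by rw [real_inner_comm]; exact h.uv, by rw [real_inner_comm]; exact h.vv⟩

theorem rotate (h : IsDualPair u v u' v') : IsDualPair v (-u) v' (-u') :=
  ⟨h.vv, by simp [h.vu], by simp [h.uv], by simp [h.uu]⟩

theorem cross_mul_cross (h : IsDualPair u v u' v') : cross u v * cross u' v' = 1 := by
  obtain ⟨h1, h2, h3, h4⟩ := h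
  rw [inner_eq_coords] at h1 h2 h3 h4
  unfold cross
  linear_combination h1 * (v 0 * v' 0 + v 1 * v' 1) + h4 - h2 * (v 0 * u' 0 + v 1 * u' 1)

theorem eq_combination (h : IsDualPair u v u' v') (x : EuclideanSpace ℝ (Fin 2)) :
    x = inner ℝ x u' • u + inner ℝ x v' • v := by
  obtain ⟨h1, h2, h3, h4⟩ := h
  rw [inner_eq_coords] at h1 h2 h3 h4
  -- Duality gives a one-sided inverse; the expansion of `x` is the product in the other order.
  have hNM : !![u' 0, u' 1; v' 0, v' 1] * !![u 0, v 0; u 1, v 1] = 1 := by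
    rw [Matrix.mul_fin_two, Matrix.one_fin_two]
    simp only [mul_comm (u' _), mul_comm (v' _), h1, h2, h3, h4]
  rw [mul_eq_one_comm, Matrix.mul_fin_two, Matrix.one_fin_two] at hNM
  have e00 := congrFun (congrFun hNM 0) 0
  have e01 := congrFun (congrFun hNM 0) 1
  have e10 := congrFun (congrFun hNM 1) 0
  have e11 := congrFun (congrFun hNM 1) 1
  simp only [Matrix.of_apply, Matrix.cons_val', Matrix.cons_val_zero, Matrix.cons_val_one,
    Matrix.cons_val_fin_one] at e00 e01 e10 e11
  apply ext_coords <;> simp only [PiLp.add_apply, PiLp.smul_apply, smul_eq_mul, inner_eq_coords]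
  · linear_combination -x 0 * e00 - x 1 * e01
  · linear_combination -x 0 * e10 - x 1 * e11

end IsDualPair

/-! ### Sectors and Meyer's inequality. -/

/-- The open cone of the vectors having positive inner product with `u'` and `v'`. -/
def posCone (u' v' : EuclideanSpace ℝ (Fin 2)) : Set (EuclideanSpace ℝ (Fin 2)) :=
  {x | 0 < inner ℝ x u' ∧ 0 < inner ℝ x v'}

theorem frameMap_image_stdTriangle_subset {C : Set (EuclideanSpace ℝ (Fin 2))}
    (hC : Convex ℝ C) (h0 : 0 ∈ C) {p q : EuclideanSpace ℝ (Fin 2)} (hp : p ∈ C) (hq : q ∈ C) :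
    frameMap p q '' stdTriangle ⊆ C := by
  rintro _ ⟨c, ⟨h0', h1', h2'⟩, rfl⟩
  have hpos : 0 < c 0 + c 1 := by linarith
  have h := hC.smul_mem_of_zero_mem h0 (convex_iff_div.1 hC hp hq h0'.le h1'.le hpos)
    ⟨hpos.le, h2'.le⟩
  rw [smul_add, smul_smul, smul_smul, mul_div_cancel₀ _ hpos.ne', mul_div_cancel₀ _ hpos.ne'] at h
  exact h

theorem volume_real_triangle_le {A : Set (EuclideanSpace ℝ (Fin 2))} (hA : volume A ≠ ⊤)
    {p q : EuclideanSpace ℝ (Fin 2)} (h : frameMap p q '' stdTriangle ⊆ A) :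
    |cross p q| ≤ 2 * volume.real A := by
  have := measureReal_mono h hA
  rw [volume_real_image_frameMap, volume_real_stdTriangle] at this
  linarith

namespace IsDualPair

variable {u v u' v' : EuclideanSpace ℝ (Fin 2)}

theorem cross_left (h : IsDualPair u v u' v') (x : EuclideanSpace ℝ (Fin 2)) :
    cross u x = inner ℝ x v' * cross u v := by
  conv_lhs => rw [h.eq_combination x]
  simp only [cross, PiLp.add_apply, PiLp.smul_apply, smul_eq_mul]
  ring

theorem cross_right (h : IsDualPair u v u' v') (x : EuclideanSpace ℝ (Fin 2)) :
    cross x v = inner ℝ x u' * cross u v := by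
  conv_lhs => rw [h.eq_combination x]
  simp only [cross, PiLp.add_apply, PiLp.smul_apply, smul_eq_mul]
  ring

/-- For `x` in the open sector, the triangles `0, u, x` and `0, x, v` are disjoint and fill part of
it; the left side is twice their total area. -/
theorem sum_mul_cross_le_volume (h : IsDualPair u v u' v') {C : Set (EuclideanSpace ℝ (Fin 2))}
    (hC : Convex ℝ C) (hfin : volume C ≠ ⊤) (h0 : 0 ∈ C) (hu : u ∈ C) (hv : v ∈ C)
    {x : EuclideanSpace ℝ (Fin 2)} (hx : x ∈ C) (hxu : inner ℝ x u' ≤ 1)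
    (hxv : inner ℝ x v' ≤ 1) :
    (inner ℝ x u' + inner ℝ x v') * |cross u v| ≤ 2 * volume.real (C ∩ posCone u' v') := by
  have hfin' : volume (C ∩ posCone u' v') ≠ ⊤ := measure_ne_top_of_subset Set.inter_subset_left hfin
  have hc : 0 ≤ |cross u v| := abs_nonneg _
  -- If the sum is at most 1, the triangle `0, u, v` suffices. Otherwise the bounds by 1 force both
  -- coordinates of `x` to be positive.
  rcases le_or_gt (inner ℝ x u' + inner ℝ x v') 1 with hle | hgt
  · have hsub : frameMap u v '' stdTriangle ⊆ C ∩ posCone u' v' := by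
      refine Set.subset_inter (frameMap_image_stdTriangle_subset hC h0 hu hv) ?_
      rintro _ ⟨c, ⟨h0', h1', -⟩, rfl⟩
      simp only [posCone, frameMap_apply, Set.mem_ofPred_eq, inner_add_left, real_inner_smul_left,
        h.uu, h.uv, h.vu, h.vv]
      constructor <;> linarith
    have := volume_real_triangle_le hfin' hsub
    nlinarith
  · have hs : 0 < inner ℝ x u' := by linarith
    have ht : 0 < inner ℝ x v' := by linarith
    -- The side of the line through `0` and `x` that contains `u`; it separates the two triangles.
    set H : Set (EuclideanSpace ℝ (Fin 2)) :=
      {y | inner ℝ x u' * inner ℝ y v' < inner ℝ x v' * inner ℝ y u'} with hH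
    have hHm : MeasurableSet H := measurableSet_lt (by fun_prop) (by fun_prop)
    have hsub1 : frameMap u x '' stdTriangle ⊆ C ∩ posCone u' v' ∩ H := by
      refine Set.subset_inter
        (Set.subset_inter (frameMap_image_stdTriangle_subset hC h0 hu hx) ?_) ?_ <;>
      · rintro _ ⟨c, ⟨h0', h1', -⟩, rfl⟩
        have := mul_pos h0' ht
        have := mul_pos h1' ht
        have := mul_pos h1' hs
        simp only [hH, posCone, frameMap_apply, Set.mem_ofPred_eq, inner_add_left,
          real_inner_smul_left, h.uu, h.uv]
        first
          | nlinarith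
          | constructor <;> linarith
    have hsub2 : frameMap x v '' stdTriangle ⊆ (C ∩ posCone u' v') \ H := by
      refine fun y hy => ⟨⟨frameMap_image_stdTriangle_subset hC h0 hx hv hy, ?_⟩, fun hyH => ?_⟩ <;>
      · obtain ⟨c, ⟨h0', h1', -⟩, rfl⟩ := hy
        have := mul_pos h0' ht
        have := mul_pos h0' hs
        have := mul_pos h1' hs
        simp only [hH, posCone, frameMap_apply, Set.mem_ofPred_eq,
          inner_add_left, real_inner_smul_left, h.vu, h.vv] at *
        first
          | nlinarith
          | constructor <;> linarith
    have e1 := volume_real_triangle_le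
      (measure_ne_top_of_subset Set.inter_subset_left hfin') hsub1
    have e2 := volume_real_triangle_le
      (measure_ne_top_of_subset Set.sdiff_subset hfin') hsub2
    rw [h.cross_left, abs_mul, abs_of_pos ht] at e1
    rw [h.cross_right, abs_mul, abs_of_pos hs] at e2
    have := measureReal_inter_add_sdiff (s := C ∩ posCone u' v') hHm hfin'
    linarith

/-- The two sectors and their negatives are disjoint pieces of `C`, separated by the signs of the
two functionals. -/
theorem two_mul_volume_add_volume_le (u' v' : EuclideanSpace ℝ (Fin 2))
    {C : Set (EuclideanSpace ℝ (Fin 2))} (hfin : volume C ≠ ⊤) (hsymm : ∀ x ∈ C, -x ∈ C) :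
    2 * (volume.real (C ∩ posCone u' v') + volume.real (C ∩ posCone v' (-u'))) ≤
      volume.real C := by
  have hm : ∀ w : EuclideanSpace ℝ (Fin 2),
      MeasurableSet {x : EuclideanSpace ℝ (Fin 2) | 0 < inner ℝ x w} :=
    fun w => measurableSet_lt (by fun_prop) (by fun_prop)
  have hneg : ∀ A : Set (EuclideanSpace ℝ (Fin 2)), volume.real (-A) = volume.real A :=
    fun A => by rw [measureReal_def, Measure.measure_neg, measureReal_def]
  have k1 := measureReal_inter_add_sdiff (s := C) (hm u') hfin
  have k2 := measureReal_inter_add_sdiff (s := C ∩ {x | 0 < inner ℝ x u'}) (hm v')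
    (measure_ne_top_of_subset Set.inter_subset_left hfin)
  have k3 := measureReal_inter_add_sdiff (s := C \ {x | 0 < inner ℝ x u'}) (hm v')
    (measure_ne_top_of_subset Set.sdiff_subset hfin)
  have s1 : C ∩ posCone u' v' ⊆
      (C ∩ {x | 0 < inner ℝ x u'}) ∩ {x | 0 < inner ℝ x v'} := by
    rintro x ⟨hxC, hx1, hx2⟩
    exact ⟨⟨hxC, hx1⟩, hx2⟩
  have m1 := measureReal_mono (μ := volume) s1
    (measure_ne_top_of_subset (fun x hx => hx.1.1) hfin)
  have s2 : -(C ∩ posCone v' (-u')) ⊆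
      (C ∩ {x | 0 < inner ℝ x u'}) \ {x | 0 < inner ℝ x v'} := by
    rintro x ⟨hxC, hx1, hx2⟩
    simp only [inner_neg_left, inner_neg_right, neg_neg] at hx1 hx2
    exact ⟨⟨by simpa using hsymm _ hxC, hx2⟩, fun (hx3 : 0 < inner ℝ x v') => by linarith⟩
  have m2 := measureReal_mono (μ := volume) s2
    (measure_ne_top_of_subset (fun x hx => hx.1.1) hfin)
  have s3 : C ∩ posCone v' (-u') ⊆
      (C \ {x | 0 < inner ℝ x u'}) ∩ {x | 0 < inner ℝ x v'} := by
    rintro x ⟨hxC, hx1, hx2⟩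
    simp only [inner_neg_right] at hx1 hx2
    exact ⟨⟨hxC, fun (hx3 : 0 < inner ℝ x u') => by linarith⟩, hx1⟩
  have m3 := measureReal_mono (μ := volume) s3
    (measure_ne_top_of_subset (fun x hx => hx.1.1) hfin)
  have s4 : -(C ∩ posCone u' v') ⊆
      (C \ {x | 0 < inner ℝ x u'}) \ {x | 0 < inner ℝ x v'} := by
    rintro x ⟨hxC, hx1, hx2⟩
    simp only [inner_neg_left] at hx1 hx2
    exact ⟨⟨by simpa using hsymm _ hxC, fun (hx3 : 0 < inner ℝ x u') => by linarith⟩, fun (hx3 : 0 < inner ℝ x v') => by linarith⟩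
  have m4 := measureReal_mono (μ := volume) s4
    (measure_ne_top_of_subset (fun x hx => hx.1.1) hfin)
  rw [hneg] at m2 m4
  linarith

/-- In a dual pair of frames inscribed in a planar convex set and in its polar, opposite sectors
satisfy Meyer's inequality. -/
theorem half_le_volume_mul_volume (h : IsDualPair u v u' v')
    {C : Set (EuclideanSpace ℝ (Fin 2))} (hC : Convex ℝ C) (hfin : volume C ≠ ⊤) (h0 : 0 ∈ C)
    (hu : u ∈ C) (hv : v ∈ C) (hC' : Convex ℝ (polarBody C)) (hfin' : volume (polarBody C) ≠ ⊤)
    (hu' : u' ∈ polarBody C) (hv' : v' ∈ polarBody C) :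
    1 / 2 ≤ volume.real (C ∩ posCone u' v') * volume.real (polarBody C ∩ posCone u v) := by
  have hdd : |cross u v| * |cross u' v'| = 1 := by rw [← abs_mul, h.cross_mul_cross, abs_one]
  have hd : 0 < |cross u v| := by
    refine (abs_nonneg _).lt_of_ne fun h => ?_
    simp [← h] at hdd
  have hsum : ∀ x ∈ C, (inner ℝ x u' + inner ℝ x v') * |cross u v| ≤
      2 * volume.real (C ∩ posCone u' v') := fun x hx =>
    h.sum_mul_cross_le_volume hC hfin h0 hu hv hx (by rw [real_inner_comm]; exact hu' x hx)
      (by rw [real_inner_comm]; exact hv' x hx)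
  set V := volume.real (C ∩ posCone u' v')
  have hV : 0 < V := by
    have := hsum u hu
    rw [h.uu, h.uv] at this
    linarith
  -- The scalar for which `hsum` says exactly that `r • (u' + v')` lies in the polar.
  set r := |cross u v| / (2 * V) with hr
  have hp : r • (u' + v') ∈ polarBody C := by
    intro x hx
    rw [real_inner_smul_left, real_inner_comm, inner_add_right, hr, div_mul_eq_mul_div,
      div_le_one (by positivity), mul_comm]
    exact hsum x hx
  have hru : inner ℝ (r • (u' + v')) u = r := by
    rw [real_inner_smul_left, inner_add_left, h.symm.uu, h.symm.vu, add_zero, mul_one]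
  have hrv : inner ℝ (r • (u' + v')) v = r := by
    rw [real_inner_smul_left, inner_add_left, h.symm.uv, h.symm.vv, zero_add, mul_one]
  have key := h.symm.sum_mul_cross_le_volume hC' hfin' (fun y _ => by simp) hu' hv' hp
    (hp u hu) (hp v hv)
  rw [hru, hrv] at key
  have hrr : (r + r) * |cross u' v'| * V = 1 := by
    rw [← hdd, hr]
    field_simp
    ring
  nlinarith [mul_le_mul_of_nonneg_right key hV.le]

end IsDualPair

/-! ### Polar bodies and the Auerbach basis. -/

theorem convex_polarBody {n : ℕ} (C : Set (EuclideanSpace ℝ (Fin n))) :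
    Convex ℝ (polarBody C) := by
  intro x hx y hy a b ha hb hab z hz
  rw [inner_add_left, real_inner_smul_left, real_inner_smul_left]
  nlinarith [hx z hz, hy z hz]

theorem neg_mem_polarBody {n : ℕ} {C : Set (EuclideanSpace ℝ (Fin n))}
    (hsymm : ∀ x ∈ C, -x ∈ C) : ∀ x ∈ polarBody C, -x ∈ polarBody C := by
  intro x hx y hy
  simpa using hx _ (hsymm y hy)

theorem exists_isDualPair {u v : EuclideanSpace ℝ (Fin 2)} (h : cross u v ≠ 0) :
    ∃ u' v', IsDualPair u v u' v' ∧
      ∀ x, inner ℝ u' x = cross x v / cross u v ∧ inner ℝ v' x = cross u x / cross u v := by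
  refine ⟨!₂[v 1 / cross u v, -v 0 / cross u v], !₂[-u 1 / cross u v, u 0 / cross u v], ?_, ?_⟩
  · constructor <;> simp only [inner_eq_coords, Matrix.cons_val_zero,
      Matrix.cons_val_one] <;> field_simp <;> unfold cross <;> ring
  · intro x
    constructor <;> simp only [inner_eq_coords, Matrix.cons_val_zero,
      Matrix.cons_val_one] <;> field_simp <;> unfold cross <;> ring

theorem IsDualPair.isBounded_polarBody {u v u' v' : EuclideanSpace ℝ (Fin 2)}
    (h : IsDualPair u v u' v') {C : Set (EuclideanSpace ℝ (Fin 2))} (hsymm : ∀ x ∈ C, -x ∈ C)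
    (hu : u ∈ C) (hv : v ∈ C) : Bornology.IsBounded (polarBody C) := by
  refine isBounded_iff_forall_norm_le.2 ⟨‖u'‖ + ‖v'‖, fun x hx => ?_⟩
  have habs : ∀ w ∈ C, ‖inner ℝ x w‖ ≤ 1 := fun w hw => abs_le.2
    ⟨by have := hx _ (hsymm w hw); rw [inner_neg_right] at this; linarith, hx w hw⟩
  rw [h.symm.eq_combination x]
  refine (norm_add_le _ _).trans ?_
  rw [norm_smul, norm_smul]
  nlinarith [habs u hu, habs v hv, norm_nonneg u', norm_nonneg v']

theorem continuous_cross :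
    Continuous fun p : EuclideanSpace ℝ (Fin 2) × EuclideanSpace ℝ (Fin 2) => cross p.1 p.2 := by
  unfold cross
  fun_prop

theorem exists_cross_ne_zero {C : Set (EuclideanSpace ℝ (Fin 2))} (h : (interior C).Nonempty) :
    ∃ u ∈ C, ∃ v ∈ C, cross u v ≠ 0 := by
  obtain ⟨x, hx⟩ := h
  obtain ⟨ε, hε, hball⟩ := Metric.mem_nhds_iff.1 (mem_interior_iff_mem_nhds.1 hx)
  have hmem : ∀ i, x + EuclideanSpace.single i (ε / 2) ∈ C := fun i => hball (by
    rw [Metric.mem_ball, dist_self_add_left, PiLp.norm_single, Real.norm_eq_abs,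
      abs_of_pos (half_pos hε)]
    exact half_lt_self hε)
  have hxC := interior_subset hx
  by_contra! hcon
  have h0 := hcon _ hxC _ (hmem 0)
  have h1 := hcon _ hxC _ (hmem 1)
  have h2 := hcon _ (hmem 0) _ (hmem 1)
  simp [cross] at h0 h1 h2
  nlinarith

/-- A maximal inscribed parallelogram: an Auerbach basis for the norm with unit ball `C`. -/
theorem exists_auerbach_basis {C : Set (EuclideanSpace ℝ (Fin 2))} (hC : IsCompact C)
    (hint : (interior C).Nonempty) (hsymm : ∀ x ∈ C, -x ∈ C) :
    ∃ u v u' v', IsDualPair u v u' v' ∧ u ∈ C ∧ v ∈ C ∧ u' ∈ polarBody C ∧ v' ∈ polarBody C := by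
  obtain ⟨p, hp, q, hq, hpq⟩ := exists_cross_ne_zero hint
  obtain ⟨⟨u, v⟩, ⟨hu, hv⟩, hmax⟩ := (hC.prod hC).exists_isMaxOn ⟨(p, q), hp, hq⟩
    continuous_cross.continuousOn
  have hmax' : ∀ x ∈ C, ∀ y ∈ C, cross x y ≤ cross u v := fun x hx y hy =>
    isMaxOn_iff.1 hmax (x, y) ⟨hx, hy⟩
  have hd : 0 < cross u v := by
    rcases hpq.lt_or_gt with h | h
    · have := hmax' _ (hsymm p hp) q hq
      simp only [cross, PiLp.neg_apply] at this h ⊢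
      linarith
    · exact h.trans_le (hmax' p hp q hq)
  obtain ⟨u', v', hdual, hinner⟩ := exists_isDualPair hd.ne'
  refine ⟨u, v, u', v', hdual, hu, hv, fun x hx => ?_, fun x hx => ?_⟩
  -- By Cramer's rule the dual functionals are quotients of determinants, at most 1 by maximality.
  · rw [(hinner x).1]
    exact (div_le_one hd).2 (hmax' x hx v hv)
  · rw [(hinner x).2]
    exact (div_le_one hd).2 (hmax' u hu x hx)

/-- Mahler's inequality for origin-symmetric convex bodies in the plane. -/
theorem eight_le_volumeProduct {C : Set (EuclideanSpace ℝ (Fin 2))} (hC : Convex ℝ C)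
    (hcomp : IsCompact C) (hint : (interior C).Nonempty) (hsymm : ∀ x ∈ C, -x ∈ C) :
    8 ≤ volumeProduct C := by
  obtain ⟨u, v, u', v', h, hu, hv, hu', hv'⟩ := exists_auerbach_basis hcomp hint hsymm
  have h0 : (0 : EuclideanSpace ℝ (Fin 2)) ∈ C := by
    have := hC hu (hsymm u hu) (by norm_num : (0 : ℝ) ≤ 1 / 2) (by norm_num : (0 : ℝ) ≤ 1 / 2)
      (by norm_num)
    simpa using this
  have hfin := hcomp.measure_lt_top (μ := volume).ne
  have hfin' := (h.isBounded_polarBody hsymm hu hv).measure_lt_top (μ := volume).ne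
  have hC' := convex_polarBody C
  have hsymm' := neg_mem_polarBody hsymm
  have e1 := h.half_le_volume_mul_volume hC hfin h0 hu hv hC' hfin' hu' hv'
  have e2 := h.rotate.half_le_volume_mul_volume hC hfin h0 hv (hsymm u hu) hC' hfin' hv'
    (hsymm' u' hu')
  have s1 := IsDualPair.two_mul_volume_add_volume_le u' v' hfin hsymm
  have s2 := IsDualPair.two_mul_volume_add_volume_le u v hfin' hsymm'
  unfold volumeProduct
  set A := volume.real (C ∩ posCone u' v')
  set B := volume.real (C ∩ posCone v' (-u'))
  set A' := volume.real (polarBody C ∩ posCone u v)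
  set B' := volume.real (polarBody C ∩ posCone v (-u))
  have hA : 0 ≤ A := measureReal_nonneg
  have hB : 0 ≤ B := measureReal_nonneg
  have hA' : 0 ≤ A' := measureReal_nonneg
  have hB' : 0 ≤ B' := measureReal_nonneg
  have hcross : 1 ≤ A * B' + A' * B := by
    refine le_of_sq_le_sq ?_ (by positivity)
    nlinarith [sq_nonneg (A * B' - A' * B),
      mul_le_mul e1 e2 (by norm_num) (by positivity : 0 ≤ A * A')]
  have hprod := mul_le_mul s1 s2 (by positivity) measureReal_nonneg
  nlinarith

/-! ### Volume product of a parallelogram. -/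

-- The vertex set is the Minkowski sum of `{p, -p}` and `{q, -q}`, so the hull is a sum of two
-- segments.
open scoped Pointwise in
theorem convexHull_parallelogram (p q : EuclideanSpace ℝ (Fin 2)) :
    convexHull ℝ {p + q, p - q, -(p + q), -(p - q)} = frameMap p q '' stdSquare := by
  have hpair : ∀ w x : EuclideanSpace ℝ (Fin 2),
      x ∈ convexHull ℝ ({w, -w} : Set (EuclideanSpace ℝ (Fin 2))) ↔
      ∃ c ∈ Set.Icc (-1 : ℝ) 1, x = c • w := by
    intro w x
    rw [convexHull_pair, segment_eq_image]
    constructor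
    · rintro ⟨t, ⟨ht0, ht1⟩, rfl⟩
      exact ⟨1 - 2 * t, ⟨by linarith, by linarith⟩, by module⟩
    · rintro ⟨c, ⟨hc0, hc1⟩, rfl⟩
      exact ⟨(1 - c) / 2, ⟨by linarith, by linarith⟩, by module⟩
  have hset : ({p + q, p - q, -(p + q), -(p - q)} : Set (EuclideanSpace ℝ (Fin 2))) =
      ({p, -p} : Set (EuclideanSpace ℝ (Fin 2))) + {q, -q} := by
    ext x
    simp only [Set.mem_add, Set.mem_insert_iff, Set.mem_singleton_iff, exists_eq_or_imp,
      exists_eq_left, ← sub_eq_add_neg, neg_add', neg_sub]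
    constructor
    · rintro (rfl | rfl | rfl | rfl) <;> simp [sub_eq_add_neg, add_comm]
    · rintro ((rfl | rfl) | (rfl | rfl)) <;> simp [sub_eq_add_neg, add_comm]
  rw [hset, convexHull_add]
  ext x
  simp only [Set.mem_add, hpair, Set.mem_image, frameMap_apply]
  constructor
  · rintro ⟨_, ⟨s, hs, rfl⟩, _, ⟨t, ht, rfl⟩, rfl⟩
    exact ⟨!₂[s, t], ⟨by simpa using hs, by simpa using ht⟩, by simp⟩
  · rintro ⟨c, ⟨h0, h1⟩, rfl⟩
    exact ⟨_, ⟨c 0, h0, rfl⟩, _, ⟨c 1, h1, rfl⟩, rfl⟩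

theorem polarBody_convexHull {n : ℕ} (s : Set (EuclideanSpace ℝ (Fin n))) :
    polarBody (convexHull ℝ s) = polarBody s := by
  refine Set.Subset.antisymm (fun x hx y hy => hx y (subset_convexHull ℝ s hy)) fun x hx => ?_
  have hconv : Convex ℝ {y : EuclideanSpace ℝ (Fin n) | inner ℝ x y ≤ 1} :=
    convex_halfSpace_le (innerₛₗ ℝ x).isLinear 1
  exact fun y hy => convexHull_min (fun z hz => hx z hz) hconv hy

theorem IsDualPair.polarBody_convexHull_eq {u v u' v' : EuclideanSpace ℝ (Fin 2)}
    (h : IsDualPair u v u' v') :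
    polarBody (convexHull ℝ {u, v, -u, -v}) = frameMap u' v' '' stdSquare := by
  rw [polarBody_convexHull]
  ext x
  constructor
  · intro hx
    have hxu : inner ℝ x u ≤ 1 := hx u (by simp)
    have hxv : inner ℝ x v ≤ 1 := hx v (by simp)
    have hxu' : inner ℝ x (-u) ≤ 1 := hx (-u) (by simp)
    have hxv' : inner ℝ x (-v) ≤ 1 := hx (-v) (by simp)
    rw [inner_neg_right] at hxu' hxv'
    refine ⟨!₂[inner ℝ x u, inner ℝ x v], ⟨⟨?_, ?_⟩, ⟨?_, ?_⟩⟩, ?_⟩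
    any_goals simp only [Matrix.cons_val_zero, Matrix.cons_val_one]; linarith
    rw [frameMap_apply]
    exact (h.symm.eq_combination x).symm
  · rintro ⟨c, ⟨⟨h0, h0'⟩, ⟨h1, h1'⟩⟩, rfl⟩ y hy
    simp only [Set.mem_insert_iff, Set.mem_singleton_iff] at hy
    rcases hy with rfl | rfl | rfl | rfl <;>
      simp only [frameMap_apply, inner_add_left, real_inner_smul_left, inner_neg_right, h.symm.uu,
        h.symm.uv, h.symm.vu, h.symm.vv] <;> linarith

/-- The volume product of a parallelogram centered at the origin. -/
theorem volumeProduct_parallelogram {a b : EuclideanSpace ℝ (Fin 2)} (h : cross a b ≠ 0) :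
    volumeProduct (convexHull ℝ {a, b, -a, -b}) = 8 := by
  obtain ⟨a', b', hdual, -⟩ := exists_isDualPair h
  have hvert : ({a, b, -a, -b} : Set (EuclideanSpace ℝ (Fin 2))) =
      {(1 / 2 : ℝ) • (a + b) + (1 / 2 : ℝ) • (a - b), (1 / 2 : ℝ) • (a + b) - (1 / 2 : ℝ) • (a - b),
        -((1 / 2 : ℝ) • (a + b) + (1 / 2 : ℝ) • (a - b)),
        -((1 / 2 : ℝ) • (a + b) - (1 / 2 : ℝ) • (a - b))} := by
    rw [show (1 / 2 : ℝ) • (a + b) + (1 / 2 : ℝ) • (a - b) = a by module,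
      show (1 / 2 : ℝ) • (a + b) - (1 / 2 : ℝ) • (a - b) = b by module]
  have hcross : cross ((1 / 2 : ℝ) • (a + b)) ((1 / 2 : ℝ) • (a - b)) = -(1 / 2) * cross a b := by
    simp only [cross, PiLp.add_apply, PiLp.sub_apply, PiLp.smul_apply, smul_eq_mul]
    ring
  have hdd : |cross a b| * |cross a' b'| = 1 := by
    rw [← abs_mul, hdual.cross_mul_cross, abs_one]
  rw [volumeProduct, hdual.polarBody_convexHull_eq, hvert, convexHull_parallelogram,
    volume_real_image_frameMap, volume_real_image_frameMap, volume_real_stdSquare, hcross, abs_mul,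
    abs_neg, abs_of_pos (by norm_num : (0 : ℝ) < 1 / 2)]
  linear_combination 8 * hdd

theorem IsCenteredSquare.volumeProduct_eq {S : Set (EuclideanSpace ℝ (Fin 2))}
    (hS : IsCenteredSquare S) : volumeProduct S = 8 := by
  obtain ⟨a, b, ha, hab, horth, rfl⟩ := hS
  refine volumeProduct_parallelogram fun h => ha ?_
  have hnorm : inner ℝ a a = inner ℝ b b := by
    rw [real_inner_self_eq_norm_sq, real_inner_self_eq_norm_sq, hab]
  rw [← inner_self_eq_zero (𝕜 := ℝ)]
  rw [inner_eq_coords] at horth hnorm ⊢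
  rw [inner_eq_coords] at hnorm
  unfold cross at h
  -- Lagrange's identity: `|a|⁴ = |a|²|b|² = ⟨a, b⟩² + (cross a b)² = 0`.
  refine pow_eq_zero_iff two_ne_zero |>.1 ?_
  linear_combination (a 0 * b 0 + a 1 * b 1) * horth + (a 0 * b 1 - a 1 * b 0) * h +
    (a 0 * a 0 + a 1 * a 1) * hnorm

theorem theorem3p6 (K : ConvexBody (EuclideanSpace ℝ (Fin 2)))
    (hKint : (interior (K : Set (EuclideanSpace ℝ (Fin 2)))).Nonempty)
    (hKsymm : ∀ x ∈ K, -x ∈ K)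
    (S : Set (EuclideanSpace ℝ (Fin 2))) (hS : IsCenteredSquare S) :
    volumeProduct S = 8 ∧
      volumeProduct (K : Set (EuclideanSpace ℝ (Fin 2))) ≥ volumeProduct S := by
  refine ⟨hS.volumeProduct_eq, ?_⟩
  rw [hS.volumeProduct_eq]
  exact eight_le_volumeProduct K.convex K.isCompact hKint hKsymm
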